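/- Let $\Omega\subset\mathbb R^n$ be a bounded, connected, nonempty open set and let $H:\Omega\times\mathbb R^n\to\mathbb R$ be a Borel function such that 1. $H\ge 0$, $H(\cdot,0)=0$, and every sublevel set $\{p: H(x,p)\le\lambda\}$ is convex; 2. for every $\lambda$ there is $M\ge0$ such that, for all $x\in\Omega$ and $p\in\mathbb R^n$, $H(x,p)\le\lambda$ implies $|p|\le M$; 3. $H(x,\cdot)$ is lower semicontinuous for every $x\in\Omega$; 4. for all $\lambda_1>\lambda_2\ge0$ there is $\alpha>0$ with $\{H(x,\cdot)<\lambda_2\}+B(0,\alpha)\subset\{H(x,\cdot)<\lambda_1\}$ for all $x\in\Omega$; 5. $H$ is continuous on $\Omega\times\mathbb R^n$. Let $g\in W^{1,\infty}(\Omega)\cap C(\overline\Omega)$, let $F(v)=\operatorname{ess\,sup}_{x\in\Omega}H(x,\nabla v(x))\in[0,\infty]$ (with $\nabla v$ the weak gradient), and let $u$ be a minimizer of $$\mu=\min\{F(v): v\in g+W^{1,\infty}(\Omega)\cap C_0(\Omega)\},\tag{S}$$ where $C_0(\Omega)$ consists of the functions continuous on $\overline\Omega$ that vanish on $\partial\Omega$.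 For $\nu\in[0,\infty]$ put $K_\nu(x)=\{p: H(x,p)\le\nu\}$ and $\varphi^0_\nu(x,q)=\sup\{p\cdot q: p\in K_\nu(x)\}$. For $x,y\in\Omega$ let $d_\nu(x,y)$ be the infimum of $\int_0^{l}\varphi^0_\nu(\gamma(s),\dot\gamma(s))\,ds$ over all $l\ge0$ and all Lipschitz curves $\gamma:[0,l]\to\Omega$ with $\gamma(0)=x$, $\gamma(l)=y$ and $|\dot\gamma|=1$ a.e. For $x,y\in\overline\Omega$ let $d_\nu(x,y)$ be the infimum of $\liminf_k d_\nu(x_k,y_k)$ over all sequences $x_k\to x$, $y_k\to y$ in $\Omega$. Write $d=d_\mu$ and $$S^-(x)=\sup_{y\in\partial\Omega}\bigl(g(y)-d(x,y)\bigr),\qquad S^+(x)=\inf_{y\in\partial\Omega}\bigl(g(y)+d(y,x)\bigr),\qquad \mathcal U=\{x\in\Omega: S^+(x)=S^-(x)\}.$$ For $x_0\in\Omega$ and $0<r<\operatorname{dist}(x_0,\partial\Omega)$ let $$\mu(x_0,r)=\inf\{\nu\ge0: u(x)-u(x_0)\le d_\nu(x_0,x)\ \text{for all }x\in B(x_0,r)\},$$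 where $d_\nu(x_0,x)$ is given by the definition for points of $\Omega$, and let $$H(x_0,\nabla u)(x_0)=\lim_{r\to0}\mu(x_0,r)=\inf_r\mu(x_0,r).$$ Then $F(u)=\mu$, and for every $x\in\mathcal U$: * if $u$ is differentiable at $x$, then $H(x,\nabla u(x))=\operatorname{ess\,sup}_{\Omega}H(\cdot,\nabla u)=\mu$; * $H(x,\nabla u)(x)=\operatorname{ess\,sup}_{\Omega}H(\cdot,\nabla u)=\mu$, whether or not $u$ is differentiable at $x$. -/

import Mathlib

open MeasureTheory Set Filter Topology
open scoped ENNReal ContDiff InnerProductSpace Pointwise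

noncomputable section

namespace Supremal

/-- `ℝⁿ` with its Euclidean structure. -/
abbrev Sp (n : ℕ) := EuclideanSpace ℝ (Fin n)

variable {n : ℕ}

/-! ### The Sobolev space `W^{1,∞}(Ω)` -/

/-- `G` is a weak gradient of `u` on the open set `Ω`. -/
structure IsWeakGradient (Ω : Set (Sp n)) (u : Sp n → ℝ) (G : Sp n → Sp n) : Prop where
  locallyIntegrable : LocallyIntegrableOn G Ω
  integral_eq : ∀ φ : Sp n → ℝ, ContDiff ℝ ∞ φ → HasCompactSupport φ → tsupport φ ⊆ Ω →
    ∀ v : Sp n, ∫ x in Ω, u x * fderiv ℝ φ x v = -∫ x in Ω, φ x * ⟪G x, v⟫_ℝ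

/-- Weak gradients are unique up to null sets. -/
theorem IsWeakGradient.ae_eq {Ω : Set (Sp n)} (hΩ : IsOpen Ω) {u : Sp n → ℝ}
    {G G' : Sp n → Sp n} (h : IsWeakGradient Ω u G) (h' : IsWeakGradient Ω u G') :
    G =ᵐ[volume.restrict Ω] G' := by
  have hint : ∀ {F : Sp n → Sp n}, LocallyIntegrableOn F Ω → ∀ φ : Sp n → ℝ, ContDiff ℝ ∞ φ →
      HasCompactSupport φ → tsupport φ ⊆ Ω → Integrable (fun x => φ x • F x) := by
    intro F hF φ hφ hc hs
    have h1 : IntegrableOn F (tsupport φ) := hF.integrableOn_compact_subset hs hc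
    have h2 : IntegrableOn (fun x => φ x • F x) (tsupport φ) :=
      h1.continuousOn_smul hφ.continuous.continuousOn hc
    refine (integrableOn_iff_integrable_of_support_subset ?_).1 h2
    intro x hx
    refine subset_tsupport φ ?_
    intro h0
    exact hx (by simp [h0])
  have key : ∀ᵐ x ∂(volume : Measure (Sp n)), x ∈ Ω → (G - G') x = 0 := by
    refine hΩ.ae_eq_zero_of_integral_contDiff_smul_eq_zero
      (h.locallyIntegrable.sub h'.locallyIntegrable) ?_
    intro φ hφ hc hs
    have i1 := hint h.locallyIntegrable φ hφ hc hs
    have i2 := hint h'.locallyIntegrable φ hφ hc hs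
    have hres : ∀ F : Sp n → Sp n, ∀ v, ∫ x in Ω, φ x * ⟪F x, v⟫_ℝ =
        ∫ x, φ x * ⟪F x, v⟫_ℝ := by
      intro F v
      refine setIntegral_eq_integral_of_forall_compl_eq_zero ?_
      intro x hx
      have : φ x = 0 := image_eq_zero_of_notMem_tsupport fun hh => hx (hs hh)
      simp [this]
    have hin : ∀ F : Sp n → Sp n, Integrable (fun x => φ x • F x) → ∀ v,
        ⟪v, ∫ x, φ x • F x⟫_ℝ = ∫ x, φ x * ⟪F x, v⟫_ℝ := by
      intro F hF v
      rw [← integral_inner hF v]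
      refine integral_congr_ae (Eventually.of_forall fun x => ?_)
      simp only [inner_smul_right, real_inner_comm]
    have e : ∫ x, φ x • G x = ∫ x, φ x • G' x := by
      refine ext_inner_left ℝ fun v => ?_
      rw [hin G i1, hin G' i2, ← hres, ← hres]
      have := (h.integral_eq φ hφ hc hs v).symm.trans (h'.integral_eq φ hφ hc hs v)
      exact neg_injective this
    simp only [Pi.sub_apply, smul_sub]
    rw [integral_sub i1 i2, e, sub_self]
  rw [Filter.EventuallyEq, ae_restrict_iff' hΩ.measurableSet]
  filter_upwards [key] with x hx hxΩ
  exact sub_eq_zero.1 (hx hxΩ)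

/-- `u ∈ W^{1,∞}(Ω)`. -/
def MemW1Inf (Ω : Set (Sp n)) (u : Sp n → ℝ) : Prop :=
  MemLp u ∞ (volume.restrict Ω) ∧
    ∃ G : Sp n → Sp n, IsWeakGradient Ω u G ∧ MemLp G ∞ (volume.restrict Ω)

/-- The weak gradient of `u` on `Ω`; by `IsWeakGradient.ae_eq` it is unique up to null sets. -/
def weakGrad (Ω : Set (Sp n)) (u : Sp n → ℝ) : Sp n → Sp n :=
  Classical.epsilon fun G => IsWeakGradient Ω u G

theorem MemW1Inf.isWeakGradient {Ω : Set (Sp n)} {u : Sp n → ℝ} (h : MemW1Inf Ω u) :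
    IsWeakGradient Ω u (weakGrad Ω u) :=
  Classical.epsilon_spec (p := fun G => IsWeakGradient Ω u G) ⟨_, h.2.choose_spec.1⟩

/-! ### The Finsler pseudo-distance of a constraint `K` -/

/-- The support function `φ⁰(x, q) = sup {p · q | p ∈ K x}` of `K x`, with values in `[0, ∞]`.
It is used only for sets `K x` that contain `0`, so the supremum is nonnegative and cutting
`p · q` at `0` does not change it. -/
def supportFn (K : Sp n → Set (Sp n)) (x q : Sp n) : ℝ≥0∞ :=
  ⨆ p ∈ K x, ENNReal.ofReal ⟪p, q⟫_ℝ

/-- `γ ∈ path(x, y)`, with length `l`: a Lipschitz curve `γ : [0, l] → Ω` from `x` to `y`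
that is parametrized by arc length. -/
structure IsPath (Ω : Set (Sp n)) (x y : Sp n) (l : ℝ) (γ : ℝ → Sp n) : Prop where
  nonneg : 0 ≤ l
  lipschitz : ∃ C, LipschitzOnWith C γ (Icc 0 l)
  mapsTo : MapsTo γ (Icc 0 l) Ω
  source : γ 0 = x
  target : γ l = y
  unit_speed : ∀ᵐ s ∂(volume.restrict (Ioo 0 l)), ‖deriv γ s‖ = 1

/-- `d(x, y)` for `x, y ∈ Ω`: the infimum of the Finslerian lengths
`∫₀ˡ φ⁰(γ(s), γ'(s)) ds` over `γ ∈ path(x, y)`. -/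
def finslerDist (Ω : Set (Sp n)) (K : Sp n → Set (Sp n)) (x y : Sp n) : ℝ≥0∞ :=
  ⨅ (l : ℝ) (γ : ℝ → Sp n) (_ : IsPath Ω x y l γ),
    ∫⁻ s in Ioo 0 l, supportFn K (γ s) (deriv γ s)

/-- The extension of `d` to the closure of `Ω`: the infimum of `liminf d(xₖ, yₖ)` over all
sequences in `Ω` with `xₖ → x` and `yₖ → y`. -/
def finslerDistBar (Ω : Set (Sp n)) (K : Sp n → Set (Sp n)) (x y : Sp n) : ℝ≥0∞ :=
  ⨅ (a : ℕ → Sp n) (b : ℕ → Sp n) (_ : ∀ k, a k ∈ Ω) (_ : ∀ k, b k ∈ Ω)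
    (_ : Tendsto a atTop (𝓝 x)) (_ : Tendsto b atTop (𝓝 y)),
    liminf (fun k => finslerDist Ω K (a k) (b k)) atTop

/-- `S⁻(x) = sup {g(y) - d(x, y) | y ∈ ∂Ω}`. -/
def extMinus (Ω : Set (Sp n)) (K : Sp n → Set (Sp n)) (g : Sp n → ℝ) (x : Sp n) : EReal :=
  ⨆ y ∈ frontier Ω, ((g y : EReal) - (finslerDistBar Ω K x y : EReal))

/-- `S⁺(x) = inf {g(y) + d(y, x) | y ∈ ∂Ω}`. -/
def extPlus (Ω : Set (Sp n)) (K : Sp n → Set (Sp n)) (g : Sp n → ℝ) (x : Sp n) : EReal :=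
  ⨅ y ∈ frontier Ω, ((g y : EReal) + (finslerDistBar Ω K y x : EReal))

/-- The uniqueness set `𝒰 = {x ∈ Ω | S⁺(x) = S⁻(x)}` of the constraint `K` and the datum `g`. -/
def uniquenessSet (Ω : Set (Sp n)) (K : Sp n → Set (Sp n)) (g : Sp n → ℝ) : Set (Sp n) :=
  {x | x ∈ Ω ∧ extPlus Ω K g x = extMinus Ω K g x}

/-! ### The supremal problem -/

/-- The standing assumptions on the supremand `H : Ω × ℝⁿ → ℝ`. -/
structure IsSupremand (Ω : Set (Sp n)) (H : Sp n → Sp n → ℝ) : Prop where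
  borel : Measurable fun z : Ω × Sp n => H z.1 z.2
  nonneg : ∀ x ∈ Ω, ∀ p, 0 ≤ H x p
  map_zero : ∀ x ∈ Ω, H x 0 = 0
  quasiconvex : ∀ x ∈ Ω, QuasiconvexOn ℝ univ (H x)
  coercive : ∀ lam : ℝ, ∃ M : ℝ, 0 ≤ M ∧ ∀ x ∈ Ω, ∀ p, H x p ≤ lam → ‖p‖ ≤ M
  lowerSemicontinuous : ∀ x ∈ Ω, LowerSemicontinuous (H x)
  sublevel_gap : ∀ lam₁ lam₂ : ℝ, 0 ≤ lam₂ → lam₂ < lam₁ → ∃ α : ℝ, 0 < α ∧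
    ∀ x ∈ Ω, {p | H x p < lam₂} + Metric.ball (0 : Sp n) α ⊆ {p | H x p < lam₁}
  continuous : ContinuousOn (fun z : Sp n × Sp n => H z.1 z.2) (Ω ×ˢ univ)

/-- `F(v, Ω) = ess sup_{x ∈ Ω} H(x, ∇v(x)) ∈ [0, ∞]` (recall that `H ≥ 0` on `Ω`). -/
def supremal (Ω : Set (Sp n)) (H : Sp n → Sp n → ℝ) (v : Sp n → ℝ) : ℝ≥0∞ :=
  essSup (fun x => ENNReal.ofReal (H x (weakGrad Ω v x))) (volume.restrict Ω)

/-- `v ∈ g + W^{1,∞}(Ω) ∩ C₀(Ω)`. -/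
structure IsAdmissible (Ω : Set (Sp n)) (g v : Sp n → ℝ) : Prop where
  sobolev : MemW1Inf Ω (v - g)
  continuousOn : ContinuousOn (v - g) (closure Ω)
  boundary : ∀ y ∈ frontier Ω, (v - g) y = 0

/-- `μ`, the infimum of `F(·, Ω)` over the admissible functions. -/
def minValue (Ω : Set (Sp n)) (H : Sp n → Sp n → ℝ) (g : Sp n → ℝ) : ℝ≥0∞ :=
  ⨅ (v : Sp n → ℝ) (_ : IsAdmissible Ω g v), supremal Ω H v

/-- `u` is a minimizer of the supremal problem with datum `g`. -/
structure IsMinimizer (Ω : Set (Sp n)) (H : Sp n → Sp n → ℝ) (g u : Sp n → ℝ) : Prop where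
  admissible : IsAdmissible Ω g u
  le : ∀ v, IsAdmissible Ω g v → supremal Ω H u ≤ supremal Ω H v

/-- `K_ν(x) = {p | H(x, p) ≤ ν}`. -/
def sublevel (H : Sp n → Sp n → ℝ) (ν : ℝ≥0∞) (x : Sp n) : Set (Sp n) :=
  {p | ENNReal.ofReal (H x p) ≤ ν}

/-- `μ(x₀, r) = inf {ν | u(x) - u(x₀) ≤ d_ν(x₀, x) for all x ∈ B(x₀, r)}`, where `d_ν` is the
Finsler pseudo-distance of `K_ν`. Since `d_ν ≥ 0`, cutting the left side at `0` is harmless. -/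
def levelAt (Ω : Set (Sp n)) (H : Sp n → Sp n → ℝ) (u : Sp n → ℝ) (x₀ : Sp n) (r : ℝ) : ℝ≥0∞ :=
  sInf {ν | ∀ x ∈ Metric.ball x₀ r,
    ENNReal.ofReal (u x - u x₀) ≤ finslerDist Ω (sublevel H ν) x₀ x}

/-- The pointwise extension `H(x₀, ∇u)(x₀) = inf_r μ(x₀, r)` over `0 < r < dist(x₀, ∂Ω)`;
as `μ(x₀, ·)` is monotone, this is also the limit as `r → 0`. -/
def pointwiseExt (Ω : Set (Sp n)) (H : Sp n → Sp n → ℝ) (u : Sp n → ℝ) (x₀ : Sp n) : ℝ≥0∞ :=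
  ⨅ (r : ℝ) (_ : 0 < r) (_ : r < Metric.infDist x₀ (frontier Ω)), levelAt Ω H u x₀ r

end Supremal

end

/-!
Write `μ` for the minimal value and `d_ν` for the pseudo-distance of the level `ν`. The claim
that `u` attains its essential supremum at the points of the uniqueness set rests on two bounds.

*Upper bound.* Since `H(·, ∇u) ≤ μ` almost everywhere, `u(b) - u(a) ≤ d_μ(a, b)` for all `a`, `b`
(`ofReal_sub_le_finslerDist`). The difficulty is that a curve may run inside the null set where
nothing is known about the weak gradient. Mollification turns an almost everywhere bound
`⟪∇u, q⟫ ≤ c` on a ball into a bound on increments (`IsWeakGradient.sub_le`), and continuity and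
coercivity of `H` make the support function of the constraint jointly upper semicontinuous
(`IsSupremand.eventually_inner_lt`). Hence the derivative of `u ∘ γ` is at most `φ⁰(γ, γ')` at
every time where both `γ` and `u ∘ γ` are differentiable, and integration gives the bound. It
yields `pointwiseExt ≤ μ`, and, through Hahn-Banach, `H(x, ∇u(x)) ≤ μ` where `u` is differentiable.

*Lower bound.* Passing to the boundary, the upper bound gives `u ≤ S⁺`, so that `u(x) ≤ S⁻(x)` on
the uniqueness set. Thus there are curves from near `x` to near the boundary along which the
increment of `u` is almost the full `μ`-length (`exists_finslerDist_lt`), and by the upper bound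
for the final piece the same holds for an initial piece of fixed Euclidean size. If
`u(y) - u(x) ≤ d_ν(x, y)` held near `x` for some `ν < μ`, that increment would be at most the
`ν`-length of the initial piece, which by the gap condition is smaller than its `μ`-length by a
fixed amount (`not_forall_ofReal_sub_le_finslerDist`). So `pointwiseExt ≥ μ`. If `u` is
differentiable at `x` with `H(x, ∇u(x)) < ν < μ`, then `u(y) - u(x) ≤ d_ν(x, y)` does hold near `x`
(`exists_forall_ofReal_sub_le_finslerDist`), which is excluded.

The infinite level needs a separate remark: there all distances between distinct points are
infinite (`finslerDist_sublevel_top`), so that the uniqueness set is empty.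
-/

noncomputable section

namespace Supremal

variable {n : ℕ}

/-! ### Weak gradients and increments -/

theorem integrable_mul_inner_of_tsupport_subset {Ω : Set (Sp n)} {F : Sp n → Sp n}
    (hF : LocallyIntegrableOn F Ω) {φ : Sp n → ℝ} (hφ : Continuous φ) (hc : HasCompactSupport φ)
    (hs : tsupport φ ⊆ Ω) (w : Sp n) : Integrable fun x => φ x * ⟪F x, w⟫_ℝ := by
  have h1 : IntegrableOn F (tsupport φ) := hF.integrableOn_compact_subset hs hc
  have h2 : IntegrableOn (fun x => φ x * ⟪F x, w⟫_ℝ) (tsupport φ) :=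
    IntegrableOn.continuousOn_mul hφ.continuousOn (h1.inner_const w) hc
  refine IntegrableOn.integrable_of_forall_notMem_eq_zero h2 ?_
  intro x hx
  rw [image_eq_zero_of_notMem_tsupport hx, zero_mul]

open ContinuousLinearMap in
/-- The derivative of a mollification is the mollified weak gradient, so it inherits one-sided
bounds that hold almost everywhere. -/
theorem IsWeakGradient.fderiv_convolution_le {Ω : Set (Sp n)} (hΩ : IsOpen Ω) {u : Sp n → ℝ}
    {G : Sp n → Sp n} (h : IsWeakGradient Ω u G) (hui : IntegrableOn u Ω) {z q : Sp n} {R c : ℝ}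
    (hB : Metric.ball z R ⊆ Ω) (hc : ∀ᵐ x ∂volume.restrict (Metric.ball z R), ⟪G x, q⟫_ℝ ≤ c)
    (ρ : ContDiffBump (0 : Sp n)) {y : Sp n} (hy : Metric.closedBall y ρ.rOut ⊆ Metric.ball z R) :
    ∃ f' : Sp n →L[ℝ] ℝ, HasFDerivAt
      (convolution (ρ.normed volume) (Ω.indicator u) (lsmul ℝ ℝ) volume) f' y ∧ f' q ≤ c := by
  set U := Ω.indicator u with hU
  have hUi : LocallyIntegrable U := ((integrable_indicator_iff hΩ.measurableSet).2 hui).locallyIntegrable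
  set f := ρ.normed volume with hf
  have hfs : HasCompactSupport f := ρ.hasCompactSupport_normed
  have hfd : ContDiff ℝ ∞ f := ρ.contDiff_normed
  have key := hfs.hasFDerivAt_convolution_right (lsmul ℝ ℝ).flip hUi (hfd.of_le (by simp)) y
  rw [convolution_flip] at key
  refine ⟨_, key, ?_⟩
  rw [convolution_precompR_apply _ hUi (hfs.fderiv ℝ) (hfd.continuous_fderiv (by simp))]
  set ψ : Sp n → ℝ := fun t => f (y - t) with hψ
  have hψd : ContDiff ℝ ∞ ψ := hfd.comp (contDiff_const.sub contDiff_id)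
  have hψs : Function.support ψ ⊆ Metric.closedBall y ρ.rOut := by
    intro t ht
    have : y - t ∈ Function.support f := ht
    rw [hf, ρ.support_normed_eq] at this
    rw [Metric.mem_closedBall, dist_comm, dist_eq_norm]
    exact (mem_ball_zero_iff.1 this).le
  have hψt : tsupport ψ ⊆ Metric.closedBall y ρ.rOut :=
    closure_minimal hψs Metric.isClosed_closedBall
  have hψc : HasCompactSupport ψ := (isCompact_closedBall y ρ.rOut).of_isClosed_subset
    (isClosed_tsupport ψ) hψt
  have hψ' : ∀ t, fderiv ℝ ψ t q = - fderiv ℝ f (y - t) q := by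
    intro t
    have h1 : HasFDerivAt f (fderiv ℝ f (y - t)) (y - t) :=
      (hfd.differentiable (by simp) _).hasFDerivAt
    have h2 : HasFDerivAt (fun t : Sp n => y - t) (-(ContinuousLinearMap.id ℝ (Sp n))) t :=
      (hasFDerivAt_id t).const_sub y
    have h3 : HasFDerivAt ψ _ t := h1.comp t h2
    rw [h3.fderiv]
    simp
  have e1 := h.integral_eq ψ hψd hψc (hψt.trans (hy.trans hB)) q
  have e2 : convolution U (fun a => fderiv ℝ f a q) (lsmul ℝ ℝ).flip volume y
      = ∫ x in Ω, ψ x * ⟪G x, q⟫_ℝ := by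
    rw [← neg_eq_iff_eq_neg.2 e1, ← integral_neg, convolution, ← integral_indicator hΩ.measurableSet]
    congr 1
    ext t
    by_cases ht : t ∈ Ω
    · simp [hU, ht, hψ', mul_comm]
    · simp [hU, ht]
  rw [e2]
  have hzero : ∀ x, x ∉ Metric.ball z R → ψ x = 0 := fun x hx => by
    by_contra h0
    exact hx (hy (hψs h0))
  have hψnn : ∀ x, 0 ≤ ψ x := fun x => ρ.nonneg_normed _
  have hψ1 : ∫ x, ψ x = 1 := by
    rw [hψ, integral_sub_left_eq_self f volume y]
    exact ρ.integral_normed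
  have e3 : ∫ x in Ω, ψ x * ⟪G x, q⟫_ℝ = ∫ x in Metric.ball z R, ψ x * ⟪G x, q⟫_ℝ := by
    rw [setIntegral_eq_integral_of_forall_compl_eq_zero (fun x hx => by
        rw [hzero x fun hx' => hx (hB hx'), zero_mul]),
      setIntegral_eq_integral_of_forall_compl_eq_zero (fun x hx => by rw [hzero x hx, zero_mul])]
  have e4 : c = ∫ x in Metric.ball z R, ψ x * c := by
    rw [setIntegral_eq_integral_of_forall_compl_eq_zero (fun x hx => by rw [hzero x hx, zero_mul]),
      integral_mul_const, hψ1, one_mul]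
  have hψi : Integrable ψ := hψd.continuous.integrable_of_hasCompactSupport hψc
  have hint : Integrable (fun x => ψ x * ⟪G x, q⟫_ℝ) (volume.restrict (Metric.ball z R)) :=
    (integrable_mul_inner_of_tsupport_subset h.locallyIntegrable hψd.continuous hψc
      (hψt.trans (hy.trans hB)) q).restrict
  rw [e3, e4]
  refine integral_mono_ae hint (hψi.mul_const c).restrict ?_
  filter_upwards [hc] with x hx
  exact mul_le_mul_of_nonneg_left hx (hψnn x)

/-- A one-sided almost everywhere bound on a directional weak derivative is a bound on the
increments in that direction. -/
theorem IsWeakGradient.sub_le {Ω : Set (Sp n)} (hΩ : IsOpen Ω) {u : Sp n → ℝ}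
    {G : Sp n → Sp n} (h : IsWeakGradient Ω u G) (huc : ContinuousOn u Ω)
    (hui : IntegrableOn u Ω) {z q : Sp n} {R c : ℝ}
    (hB : Metric.ball z R ⊆ Ω) (hc : ∀ᵐ x ∂volume.restrict (Metric.ball z R), ⟪G x, q⟫_ℝ ≤ c)
    {y : Sp n} {t : ℝ} (ht : 0 ≤ t) (hy : y ∈ Metric.ball z R)
    (hy' : y + t • q ∈ Metric.ball z R) : u (y + t • q) - u y ≤ c * t := by
  set U := Ω.indicator u with hU
  have hUm : AEStronglyMeasurable U volume :=
    ((integrable_indicator_iff hΩ.measurableSet).2 hui).aestronglyMeasurable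
  have hUc : ∀ w ∈ Metric.ball z R, U w = u w ∧ ContinuousAt U w := by
    intro w hw
    refine ⟨indicator_of_mem (hB hw) u, ?_⟩
    refine (huc.continuousAt (hΩ.mem_nhds (hB hw))).congr ?_
    filter_upwards [hΩ.mem_nhds (hB hw)] with x hx
    exact (indicator_of_mem hx u).symm
  refine le_of_forall_pos_le_add fun ε hε => ?_
  obtain ⟨δ₁, hδ₁, H1⟩ := Metric.continuousAt_iff.1 (hUc _ hy).2 (ε / 2) (half_pos hε)
  obtain ⟨δ₂, hδ₂, H2⟩ := Metric.continuousAt_iff.1 (hUc _ hy').2 (ε / 2) (half_pos hε)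
  -- the mollification radius keeps the whole segment well inside the ball
  set δ := min (min δ₁ δ₂) (min (R - dist y z) (R - dist (y + t • q) z)) / 2 with hδ
  have hpos : 0 < min (min δ₁ δ₂) (min (R - dist y z) (R - dist (y + t • q) z)) :=
    lt_min (lt_min hδ₁ hδ₂) (lt_min (sub_pos.2 hy) (sub_pos.2 hy'))
  have hδ0 : 0 < δ := half_pos hpos
  have hδlt : δ < min (min δ₁ δ₂) (min (R - dist y z) (R - dist (y + t • q) z)) :=
    half_lt_self hpos
  simp only [lt_min_iff] at hδlt
  obtain ⟨⟨d1, d2⟩, d3, d4⟩ := hδlt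
  let ρ : ContDiffBump (0 : Sp n) := ⟨δ / 2, δ, half_pos hδ0, half_lt_self hδ0⟩
  have hρ : ρ.rOut = δ := rfl
  set V := convolution (ρ.normed volume) U (ContinuousLinearMap.lsmul ℝ ℝ) volume with hV
  have a1 : dist (V y) (U y) ≤ ε / 2 := ρ.dist_normed_convolution_le hUm fun x hx =>
    (H1 ((Metric.mem_ball.1 hx).trans (by rw [hρ]; exact d1))).le
  have a2 : dist (V (y + t • q)) (U (y + t • q)) ≤ ε / 2 :=
    ρ.dist_normed_convolution_le hUm fun x hx =>
      (H2 ((Metric.mem_ball.1 hx).trans (by rw [hρ]; exact d2))).le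
  have hin : ∀ s ∈ Icc 0 t, y + s • q ∈ Metric.ball z (R - δ) := by
    intro s hs
    have hA : y ∈ Metric.ball z (R - δ) := by rw [Metric.mem_ball]; linarith
    have hB' : y + t • q ∈ Metric.ball z (R - δ) := by rw [Metric.mem_ball]; linarith
    rcases ht.eq_or_lt with h0 | h0
    · have : s = 0 := le_antisymm (hs.2.trans h0.symm.le) hs.1
      simpa [this] using hA
    have := (convex_ball z (R - δ)).add_smul_sub_mem hA hB' (t := s / t)
      ⟨div_nonneg hs.1 ht, (div_le_one h0).2 hs.2⟩
    rwa [add_sub_cancel_left, smul_smul, div_mul_cancel₀ _ h0.ne'] at this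
  have hder : ∀ s ∈ Icc 0 t, ∃ d, HasDerivAt (fun s : ℝ => V (y + s • q)) d s ∧ d ≤ c := by
    intro s hs
    obtain ⟨f', h1, h2⟩ := h.fderiv_convolution_le hΩ hui hB hc ρ (y := y + s • q) (by
      rw [hρ]
      refine Metric.closedBall_subset_ball' ?_
      have := hin s hs
      rw [Metric.mem_ball] at this
      linarith)
    refine ⟨f' q, ?_, h2⟩
    have h3 : HasDerivAt (fun s : ℝ => y + s • q) q s := by
      simpa using ((hasDerivAt_id s).smul_const q).const_add y
    exact h1.comp_hasDerivAt s h3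
  have hmv := (convex_Icc (0 : ℝ) t).image_sub_le_mul_sub_of_deriv_le
    (f := fun s : ℝ => V (y + s • q)) (C := c)
    (fun s hs => (hder s hs).choose_spec.1.continuousAt.continuousWithinAt)
    (fun s hs => (hder s (interior_subset hs)).choose_spec.1.differentiableAt.differentiableWithinAt)
    (fun s hs => by
      obtain ⟨d, hd, hdc⟩ := hder s (interior_subset hs)
      rw [hd.deriv]; exact hdc) 0 (left_mem_Icc.2 ht) t (right_mem_Icc.2 ht) ht
  simp only [zero_smul, add_zero, sub_zero] at hmv
  rw [(hUc _ hy).1, Real.dist_eq, abs_le] at a1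
  rw [(hUc _ hy').1, Real.dist_eq, abs_le] at a2
  linarith [a1.1, a1.2, a2.1, a2.2]

/-! ### Sublevel sets and their support functions -/

section SupportFunction

variable {Ω : Set (Sp n)} {H : Sp n → Sp n → ℝ} {μ ν : ℝ≥0∞}

theorem ofReal_inner_le_supportFn {K : Sp n → Set (Sp n)} {x p : Sp n} (hp : p ∈ K x) (q : Sp n) :
    ENNReal.ofReal ⟪p, q⟫_ℝ ≤ supportFn K x q :=
  le_iSup₂ (f := fun p (_ : p ∈ K x) => ENNReal.ofReal ⟪p, q⟫_ℝ) p hp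

theorem mem_sublevel_iff (hν : ν ≠ ⊤) {x p : Sp n} : p ∈ sublevel H ν x ↔ H x p ≤ ν.toReal :=
  ENNReal.ofReal_le_iff_le_toReal hν

theorem IsSupremand.zero_mem_sublevel (hH : IsSupremand Ω H) {x : Sp n} (hx : x ∈ Ω) :
    (0 : Sp n) ∈ sublevel H ν x := by
  simp [sublevel, hH.map_zero x hx]

theorem IsSupremand.continuousAt (hΩ : IsOpen Ω) (hH : IsSupremand Ω H) {x : Sp n} (hx : x ∈ Ω)
    (p : Sp n) : ContinuousAt (fun z : Sp n × Sp n => H z.1 z.2) (x, p) :=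
  hH.continuous.continuousAt ((hΩ.prod isOpen_univ).mem_nhds ⟨hx, mem_univ p⟩)

theorem IsSupremand.convex_sublevel (hH : IsSupremand Ω H) (hν : ν ≠ ⊤) {x : Sp n} (hx : x ∈ Ω) :
    Convex ℝ (sublevel H ν x) := by
  have h := hH.quasiconvex x hx ν.toReal
  have e : sublevel H ν x = {p | p ∈ univ ∧ H x p ≤ ν.toReal} := by
    ext p
    simp [mem_sublevel_iff hν]
  rw [e]
  exact h

theorem IsSupremand.isClosed_sublevel (hH : IsSupremand Ω H) (hν : ν ≠ ⊤) {x : Sp n}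
    (hx : x ∈ Ω) : IsClosed (sublevel H ν x) := by
  have e : sublevel H ν x = H x ⁻¹' Iic ν.toReal := by
    ext p
    simp [mem_sublevel_iff hν]
  rw [e]
  exact (hH.lowerSemicontinuous x hx).isClosed_preimage _

theorem IsSupremand.exists_norm_le (hH : IsSupremand Ω H) (hν : ν ≠ ⊤) :
    ∃ M : ℝ, 0 ≤ M ∧ ∀ x ∈ Ω, ∀ p ∈ sublevel H ν x, ‖p‖ ≤ M := by
  obtain ⟨M, h0, hM⟩ := hH.coercive ν.toReal
  exact ⟨M, h0, fun x hx p hp => hM x hx p ((mem_sublevel_iff hν).1 hp)⟩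

theorem supportFn_le_of_norm_le {K : Sp n → Set (Sp n)} {x : Sp n} {M : ℝ}
    (hM : ∀ p ∈ K x, ‖p‖ ≤ M) {q : Sp n} (hq : ‖q‖ = 1) : supportFn K x q ≤ ENNReal.ofReal M := by
  refine iSup₂_le fun p hp => ENNReal.ofReal_le_ofReal ?_
  have := real_inner_le_norm p q
  rw [hq, mul_one] at this
  exact this.trans (hM p hp)

/-- The constraint sets are upper hemicontinuous with bounded values, so that the support
function is upper semicontinuous in both variables jointly. -/
theorem IsSupremand.eventually_inner_lt (hΩ : IsOpen Ω) (hH : IsSupremand Ω H) (hν : ν ≠ ⊤)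
    {z q : Sp n} (hz : z ∈ Ω) {c : ℝ} (hc : supportFn (sublevel H ν) z q < ENNReal.ofReal c) :
    ∀ᶠ w : Sp n × Sp n in 𝓝 (z, q), w.1 ∈ Ω ∧ ∀ p ∈ sublevel H ν w.1, ⟪p, w.2⟫_ℝ < c := by
  obtain ⟨M, -, hM⟩ := hH.exists_norm_le hν
  have h1 : ∀ᶠ w : Sp n × Sp n in 𝓝 (z, q), w.1 ∈ Ω :=
    continuousAt_fst.eventually_mem (hΩ.mem_nhds hz)
  have h2 : ∀ᶠ w : Sp n × Sp n in 𝓝 (z, q), ∀ p ∈ Metric.closedBall (0 : Sp n) M,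
      ν.toReal < H w.1 p ∨ ⟪p, w.2⟫_ℝ < c := by
    refine (isCompact_closedBall (0 : Sp n) M).eventually_forall_of_forall_eventually
      (P := fun (w : Sp n × Sp n) (p : Sp n) => ν.toReal < H w.1 p ∨ ⟪p, w.2⟫_ℝ < c) fun p _ => ?_
    by_cases hp : H z p ≤ ν.toReal
    · have hlt : ⟪p, q⟫_ℝ < c := by
        have := (ofReal_inner_le_supportFn ((mem_sublevel_iff hν).2 hp) q).trans_lt hc
        exact (ENNReal.ofReal_lt_ofReal_iff'.1 this).1
      have hcont : Continuous fun w : (Sp n × Sp n) × Sp n => ⟪w.2, w.1.2⟫_ℝ := by fun_prop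
      filter_upwards [hcont.continuousAt.eventually_lt continuousAt_const hlt] with w hw
      exact Or.inr hw
    · have hcont : ContinuousAt (fun w : (Sp n × Sp n) × Sp n => H w.1.1 w.2) ((z, q), p) :=
        ContinuousAt.comp (g := fun z : Sp n × Sp n => H z.1 z.2)
          (f := fun w : (Sp n × Sp n) × Sp n => (w.1.1, w.2)) (x := ((z, q), p))
          (hH.continuousAt hΩ hz p) (by fun_prop)
      filter_upwards [continuousAt_const.eventually_lt hcont (not_le.1 hp)] with w hw
      exact Or.inl hw
  filter_upwards [h1, h2] with w hw1 hw2
  refine ⟨hw1, fun p hp => ?_⟩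
  exact (hw2 p (mem_closedBall_zero_iff.2 (hM _ hw1 p hp))).resolve_left
    (not_lt.2 ((mem_sublevel_iff hν).1 hp))

/-- The gap condition for closed sublevel sets. It applies to strict ones, hence is used between
`μ` and the midpoint of `ν` and `μ`. -/
theorem IsSupremand.exists_add_mem_sublevel (hH : IsSupremand Ω H) (h : ν < μ) (hμ : μ ≠ ⊤) :
    ∃ α : ℝ, 0 < α ∧ ∀ x ∈ Ω, ∀ p ∈ sublevel H ν x, ∀ e : Sp n, ‖e‖ ≤ α →
      p + e ∈ sublevel H μ x := by
  have hν : ν ≠ ⊤ := (h.trans_le le_top).ne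
  have hlt : ν.toReal < μ.toReal := (ENNReal.toReal_lt_toReal hν hμ).2 h
  have h0 : 0 ≤ ν.toReal := ENNReal.toReal_nonneg
  obtain ⟨α, hα, H'⟩ := hH.sublevel_gap μ.toReal ((ν.toReal + μ.toReal) / 2) (by linarith)
    (by linarith)
  refine ⟨α / 2, half_pos hα, fun x hx p hp e he => ?_⟩
  rw [mem_sublevel_iff hν] at hp
  rw [mem_sublevel_iff hμ]
  refine le_of_lt (H' x hx (add_mem_add ?_ ?_))
  · show H x p < _
    linarith
  · rw [mem_ball_zero_iff]
    linarith

theorem IsSupremand.exists_closedBall_subset_sublevel (hH : IsSupremand Ω H) (h : 0 < μ)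
    (hμ : μ ≠ ⊤) : ∃ β : ℝ, 0 < β ∧ ∀ x ∈ Ω, ∀ e : Sp n, ‖e‖ ≤ β → e ∈ sublevel H μ x := by
  obtain ⟨α, hα, H'⟩ := hH.exists_add_mem_sublevel h hμ
  refine ⟨α, hα, fun x hx e he => ?_⟩
  simpa using H' x hx 0 (hH.zero_mem_sublevel hx) e he

/-- Raising the level from `ν` to `μ` costs a fixed amount per unit of length. -/
theorem IsSupremand.exists_supportFn_add_le (hH : IsSupremand Ω H) (h : ν < μ) (hμ : μ ≠ ⊤) :
    ∃ α : ℝ, 0 < α ∧ ∀ x ∈ Ω, ∀ q : Sp n, ‖q‖ = 1 →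
      supportFn (sublevel H ν) x q + ENNReal.ofReal α ≤ supportFn (sublevel H μ) x q := by
  obtain ⟨α, hα, H'⟩ := hH.exists_add_mem_sublevel h hμ
  refine ⟨α, hα, fun x hx q hq => ?_⟩
  have key : ∀ p ∈ sublevel H ν x,
      ENNReal.ofReal (⟪p, q⟫_ℝ + α) ≤ supportFn (sublevel H μ) x q := by
    intro p hp
    have := ofReal_inner_le_supportFn
      (H' x hx p hp (α • q) (by rw [norm_smul, hq, mul_one, Real.norm_of_nonneg hα.le])) q
    rwa [inner_add_left, real_inner_smul_left, real_inner_self_eq_norm_sq, hq, one_pow,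
      mul_one] at this
  rw [supportFn, ENNReal.biSup_add ⟨0, hH.zero_mem_sublevel hx⟩]
  refine iSup₂_le fun p hp => ?_
  rcases le_total 0 ⟪p, q⟫_ℝ with h0 | h0
  · rw [← ENNReal.ofReal_add h0 hα.le]
    exact key p hp
  · rw [ENNReal.ofReal_of_nonpos h0, zero_add]
    simpa using key 0 (hH.zero_mem_sublevel hx)

/-- A closed convex set is determined by its support function. -/
theorem IsSupremand.mem_sublevel_of_inner_le (hH : IsSupremand Ω H) (hν : ν ≠ ⊤) {x p : Sp n}
    (hx : x ∈ Ω) (h : ∀ q, ENNReal.ofReal ⟪p, q⟫_ℝ ≤ supportFn (sublevel H ν) x q) :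
    p ∈ sublevel H ν x := by
  by_contra hp
  obtain ⟨f, s, hf, hs⟩ := geometric_hahn_banach_closed_point (hH.convex_sublevel hν hx)
    (hH.isClosed_sublevel hν hx) hp
  set q := (InnerProductSpace.toDual ℝ (Sp n)).symm f with hq
  have hfq : ∀ a, f a = ⟪a, q⟫_ℝ := fun a => by
    rw [real_inner_comm, hq, InnerProductSpace.toDual_symm_apply]
  have hs0 : 0 < s := by simpa using hf 0 (hH.zero_mem_sublevel hx)
  have h1 : supportFn (sublevel H ν) x q ≤ ENNReal.ofReal s :=
    iSup₂_le fun a ha => ENNReal.ofReal_le_ofReal ((hfq a) ▸ (hf a ha).le)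
  have h2 : ENNReal.ofReal s < ENNReal.ofReal ⟪p, q⟫_ℝ :=
    (ENNReal.ofReal_lt_ofReal_iff (hs0.trans ((hfq p) ▸ hs))).2 ((hfq p) ▸ hs)
  exact absurd ((h q).trans h1) (not_le.2 h2)

end SupportFunction

/-! ### Increments along curves -/

/-- The fundamental theorem of calculus as an inequality for lower integrals, which asks for no
measurability of the bound. -/
theorem ofReal_sub_le_lintegral {f : ℝ → ℝ} {a b : ℝ} (hab : a ≤ b) {C : NNReal}
    (hf : LipschitzOnWith C f (Icc a b)) {φ : ℝ → ℝ≥0∞}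
    (h : ∀ᵐ s ∂volume.restrict (Ioo a b), DifferentiableAt ℝ f s →
      ENNReal.ofReal (deriv f s) ≤ φ s) :
    ENNReal.ofReal (f b - f a) ≤ ∫⁻ s in Ioo a b, φ s := by
  have hac : AbsolutelyContinuousOnInterval f a b :=
    LipschitzOnWith.absolutelyContinuousOnInterval (by rwa [uIcc_of_le hab])
  have hint : IntegrableOn (deriv f) (Ioo a b) := by
    have := hac.intervalIntegrable_deriv
    rw [intervalIntegrable_iff_integrableOn_Ioo_of_le hab] at this
    exact this
  rw [← hac.integral_deriv_eq_sub, intervalIntegral.integral_of_le hab, integral_Ioc_eq_integral_Ioo,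
    integral_eq_lintegral_pos_part_sub_lintegral_neg_part hint]
  calc _ ≤ ENNReal.ofReal (∫⁻ s in Ioo a b, ENNReal.ofReal (deriv f s)).toReal :=
        ENNReal.ofReal_le_ofReal (sub_le_self _ ENNReal.toReal_nonneg)
    _ ≤ ∫⁻ s in Ioo a b, ENNReal.ofReal (deriv f s) := ENNReal.ofReal_toReal_le
    _ ≤ _ := by
        refine lintegral_mono_ae ?_
        filter_upwards [h] with s hs
        -- `deriv f s = 0` where `f` is not differentiable, and the bound is trivial there
        by_cases hd : DifferentiableAt ℝ f s
        · exact hs hd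
        · simp [deriv_zero_of_not_differentiableAt hd]

theorem differentiableAt_of_norm_deriv_eq_one {γ : ℝ → Sp n} {s : ℝ} (h : ‖deriv γ s‖ = 1) :
    DifferentiableAt ℝ γ s := by
  by_contra h'
  simp [deriv_zero_of_not_differentiableAt h'] at h

/-- A constant covector in the constraint bounds the length of a curve from below. -/
theorem ofReal_inner_sub_le_lintegral {γ : ℝ → Sp n} {a b : ℝ} (hab : a ≤ b) {C : NNReal}
    (hγ : LipschitzOnWith C γ (Icc a b))
    (h1 : ∀ᵐ s ∂volume.restrict (Ioo a b), ‖deriv γ s‖ = 1) {p : Sp n} {φ : ℝ → ℝ≥0∞}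
    (hp : ∀ s ∈ Ioo a b, ‖deriv γ s‖ = 1 → ENNReal.ofReal ⟪p, deriv γ s⟫_ℝ ≤ φ s) :
    ENNReal.ofReal ⟪p, γ b - γ a⟫_ℝ ≤ ∫⁻ s in Ioo a b, φ s := by
  rw [inner_sub_right]
  refine ofReal_sub_le_lintegral (f := fun s => innerSL ℝ p (γ s)) hab
    ((innerSL ℝ p).lipschitz.comp_lipschitzOnWith hγ) ?_
  filter_upwards [h1, ae_restrict_mem measurableSet_Ioo] with s hs hs' _
  have hd := (differentiableAt_of_norm_deriv_eq_one hs).hasDerivAt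
  have hd' : HasDerivAt (fun s => innerSL ℝ p (γ s)) (innerSL ℝ p (deriv γ s)) s :=
    (innerSL ℝ p).hasFDerivAt.comp_hasDerivAt s hd
  rw [hd'.deriv]
  exact hp s hs' hs

theorem exists_norm_le_one_inner_eq_norm (v : Sp n) : ∃ e : Sp n, ‖e‖ ≤ 1 ∧ ⟪e, v⟫_ℝ = ‖v‖ := by
  refine ⟨‖v‖⁻¹ • v, ?_, ?_⟩
  · rw [norm_smul, norm_inv, norm_norm]
    exact inv_mul_le_one
  · rw [real_inner_smul_left, real_inner_self_eq_norm_sq, pow_two, ← mul_assoc, inv_mul_mul_self]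

theorem norm_sub_le_of_unit_speed {γ : ℝ → Sp n} {a b : ℝ} (hab : a ≤ b) {C : NNReal}
    (hγ : LipschitzOnWith C γ (Icc a b))
    (h1 : ∀ᵐ s ∂volume.restrict (Ioo a b), ‖deriv γ s‖ = 1) : ‖γ b - γ a‖ ≤ b - a := by
  obtain ⟨e, he, he'⟩ := exists_norm_le_one_inner_eq_norm (γ b - γ a)
  have h := ofReal_inner_sub_le_lintegral hab hγ h1 (p := e)
    (φ := fun _ => 1) (fun s _ hs => by
      refine ENNReal.ofReal_le_one.2 ((real_inner_le_norm _ _).trans ?_)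
      rwa [hs, mul_one])
  rwa [he', lintegral_const, Measure.restrict_apply_univ,
    Real.volume_Ioo, one_mul, ENNReal.ofReal_le_ofReal_iff (sub_nonneg.2 hab)] at h

/-- A continuous integrable function on `Ω` with a weak gradient in `K x` for almost every `x`. -/
structure HasGradientIn (Ω : Set (Sp n)) (K : Sp n → Set (Sp n)) (u : Sp n → ℝ) : Prop where
  continuousOn : ContinuousOn u Ω
  integrableOn : IntegrableOn u Ω
  exists_weakGradient : ∃ G : Sp n → Sp n, IsWeakGradient Ω u G ∧
    ∀ᵐ x ∂volume.restrict Ω, G x ∈ K x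

section Curves

variable {Ω : Set (Sp n)} {H : Sp n → Sp n → ℝ} {μ ν : ℝ≥0∞} {u : Sp n → ℝ}

/-- The gradient constraint controls increments in all directions near `q`, uniformly near `z`,
with any constant above the support function at `(z, q)`. -/
theorem HasGradientIn.exists_sub_le (hΩ : IsOpen Ω) (hH : IsSupremand Ω H) (hν : ν ≠ ⊤)
    (hu : HasGradientIn Ω (sublevel H ν) u) {z q : Sp n} (hz : z ∈ Ω) {c : ℝ}
    (hc : supportFn (sublevel H ν) z q < ENNReal.ofReal c) :
    ∃ δ > 0, ∀ y ∈ Metric.ball z δ, ∀ q' ∈ Metric.ball q δ, ∀ t : ℝ, 0 ≤ t →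
      y + t • q' ∈ Metric.ball z δ → u (y + t • q') - u y ≤ c * t := by
  obtain ⟨δ, hδ, h⟩ := Metric.eventually_nhds_iff_ball.1 (hH.eventually_inner_lt hΩ hν hz hc)
  obtain ⟨G, hG, hGK⟩ := hu.exists_weakGradient
  have hprod : ∀ y ∈ Metric.ball z δ, ∀ q' ∈ Metric.ball q δ,
      y ∈ Ω ∧ ∀ p ∈ sublevel H ν y, ⟪p, q'⟫_ℝ < c := fun y hy q' hq' =>
    h (y, q') (by rw [← ball_prod_same]; exact ⟨hy, hq'⟩)
  have hB : Metric.ball z δ ⊆ Ω := fun y hy => (hprod y hy q (Metric.mem_ball_self hδ)).1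
  refine ⟨δ, hδ, fun y hy q' hq' t ht hy' => ?_⟩
  refine hG.sub_le hΩ hu.continuousOn hu.integrableOn hB ?_ ht hy hy'
  filter_upwards [ae_restrict_of_ae_restrict_of_subset hB hGK,
    ae_restrict_mem Metric.isOpen_ball.measurableSet] with w hw hw'
  exact ((hprod w hw' q' hq').2 _ hw).le

theorem HasGradientIn.exists_lipschitzOnWith (hΩ : IsOpen Ω) (hH : IsSupremand Ω H) (hν : ν ≠ ⊤)
    (hu : HasGradientIn Ω (sublevel H ν) u) :
    ∃ C : NNReal, ∀ (z : Sp n) (R : ℝ), Metric.ball z R ⊆ Ω →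
      LipschitzOnWith C u (Metric.ball z R) := by
  obtain ⟨M, hM0, hM⟩ := hH.exists_norm_le hν
  obtain ⟨G, hG, hGK⟩ := hu.exists_weakGradient
  refine ⟨M.toNNReal, fun z R hB => LipschitzOnWith.of_le_add_mul _ fun x hx y hy => ?_⟩
  have := hG.sub_le hΩ hu.continuousOn hu.integrableOn hB (q := x - y) (c := M * ‖x - y‖) ?_
    zero_le_one hy (by simpa using hx)
  · rw [one_smul, add_sub_cancel, mul_one] at this
    rw [Real.coe_toNNReal _ hM0, dist_eq_norm]
    linarith
  · filter_upwards [ae_restrict_of_ae_restrict_of_subset hB hGK,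
      ae_restrict_mem Metric.isOpen_ball.measurableSet] with w hw hw'
    exact (real_inner_le_norm _ _).trans
      (mul_le_mul_of_nonneg_right (hM w (hB hw') _ hw) (norm_nonneg _))

/-- The increment of `u` along a curve is at most the Finslerian length of the curve. At a time
of differentiability the bound on the derivative comes from a full neighbourhood, so that it
does not matter on which null set the weak gradient is unconstrained. -/
theorem HasGradientIn.ofReal_sub_le_lintegral (hΩ : IsOpen Ω) (hH : IsSupremand Ω H) (hν : ν ≠ ⊤)
    (hu : HasGradientIn Ω (sublevel H ν) u) {γ : ℝ → Sp n} {a b : ℝ} (hab : a ≤ b) {C : NNReal}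
    (hγ : LipschitzOnWith C γ (Icc a b)) (hmaps : MapsTo γ (Icc a b) Ω)
    (h1 : ∀ᵐ s ∂volume.restrict (Ioo a b), ‖deriv γ s‖ = 1) :
    ENNReal.ofReal (u (γ b) - u (γ a)) ≤
      ∫⁻ s in Ioo a b, supportFn (sublevel H ν) (γ s) (deriv γ s) := by
  obtain ⟨D, hD⟩ := hu.exists_lipschitzOnWith hΩ hH hν
  have hloc : LocallyLipschitzOn (Icc a b) (u ∘ γ) := by
    intro s hs
    obtain ⟨R, hR, hRΩ⟩ := Metric.isOpen_iff.1 hΩ (γ s) (hmaps hs)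
    refine ⟨D * C, γ ⁻¹' Metric.ball (γ s) R ∩ Icc a b, ?_, ?_⟩
    · exact inter_mem ((hγ.continuousOn s hs) (Metric.ball_mem_nhds _ hR)) self_mem_nhdsWithin
    · exact (hD _ _ hRΩ).comp (hγ.mono inter_subset_right) fun _ h => h.1
  obtain ⟨E, hE⟩ := hloc.exists_lipschitzOnWith_of_compact isCompact_Icc
  refine Supremal.ofReal_sub_le_lintegral hab hE ?_
  filter_upwards [h1, ae_restrict_mem measurableSet_Ioo] with s hs hs' hd
  have hds := differentiableAt_of_norm_deriv_eq_one hs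
  by_contra! hlt
  obtain ⟨c, -, hc1, hc2⟩ := ENNReal.lt_iff_exists_real_btwn.1 hlt
  obtain ⟨δ, hδ, hsub⟩ := hu.exists_sub_le hΩ hH hν (hmaps (Ioo_subset_Icc_self hs')) hc1
  have hslope : Tendsto (fun t : ℝ => t⁻¹ • (γ (s + t) - γ s)) (𝓝[>] 0) (𝓝 (deriv γ s)) :=
    hds.hasDerivAt.tendsto_slope_zero_right
  have hslope' : Tendsto (fun t : ℝ => t⁻¹ • ((u ∘ γ) (s + t) - (u ∘ γ) s)) (𝓝[>] 0)
      (𝓝 (deriv (u ∘ γ) s)) := hd.hasDerivAt.tendsto_slope_zero_right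
  have hcont : Tendsto (fun t : ℝ => γ (s + t)) (𝓝[>] 0) (𝓝 (γ s)) := by
    have : ContinuousAt (fun t : ℝ => γ (s + t)) 0 := by
      refine ContinuousAt.comp (g := γ) ?_ (by fun_prop)
      simpa using hds.continuousAt
    have h := this.tendsto
    rw [add_zero] at h
    exact h.mono_left nhdsWithin_le_nhds
  have hle : deriv (u ∘ γ) s ≤ c := by
    refine le_of_tendsto hslope' ?_
    filter_upwards [hslope (Metric.ball_mem_nhds _ hδ), hcont (Metric.ball_mem_nhds _ hδ),
      self_mem_nhdsWithin] with t ht1 ht2 ht3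
    have ht3 : 0 < t := ht3
    have e : γ s + t • (t⁻¹ • (γ (s + t) - γ s)) = γ (s + t) := by
      rw [smul_inv_smul₀ ht3.ne', add_sub_cancel]
    have := hsub (γ s) (Metric.mem_ball_self hδ) _ ht1 t ht3.le (by rw [e]; exact ht2)
    rw [e] at this
    rw [smul_eq_mul, inv_mul_le_iff₀ ht3, mul_comm t c]
    exact this
  exact absurd (ENNReal.ofReal_le_ofReal hle) (not_le.2 hc2)

theorem ofReal_sub_le_finslerDist (hΩ : IsOpen Ω) (hH : IsSupremand Ω H) (hν : ν ≠ ⊤)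
    (hu : HasGradientIn Ω (sublevel H ν) u) (x y : Sp n) :
    ENNReal.ofReal (u y - u x) ≤ finslerDist Ω (sublevel H ν) x y := by
  refine le_iInf fun l => le_iInf fun γ => le_iInf fun hγ => ?_
  obtain ⟨C, hC⟩ := hγ.lipschitz
  have := hu.ofReal_sub_le_lintegral hΩ hH hν hγ.nonneg hC hγ.mapsTo hγ.unit_speed
  rwa [hγ.source, hγ.target] at this

/-- Without a constraint no two distinct points are at finite distance. -/
theorem finslerDist_sublevel_top {x y : Sp n} (hxy : x ≠ y) :
    finslerDist Ω (sublevel H ⊤) x y = ⊤ := by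
  refine iInf_eq_top.2 fun l => iInf_eq_top.2 fun γ => iInf_eq_top.2 fun hγ => ?_
  have hl : 0 < l := hγ.nonneg.lt_of_ne fun h => hxy (by rw [← hγ.source, ← hγ.target, ← h])
  have htop : ∀ q : Sp n, ‖q‖ = 1 → ∀ z, supportFn (sublevel H ⊤) z q = ⊤ := by
    intro q hq z
    refine ENNReal.eq_top_of_forall_nnreal_le fun r => ?_
    have := ofReal_inner_le_supportFn (K := sublevel H ⊤) (x := z) (p := (r : ℝ) • q)
      (show ENNReal.ofReal _ ≤ ⊤ from le_top) q
    rwa [real_inner_smul_left, real_inner_self_eq_norm_sq, hq, one_pow, mul_one,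
      ENNReal.ofReal_coe_nnreal] at this
  calc ∫⁻ s in Ioo 0 l, supportFn (sublevel H ⊤) (γ s) (deriv γ s)
      = ∫⁻ s in Ioo 0 l, ⊤ := by
        refine lintegral_congr_ae ?_
        filter_upwards [hγ.unit_speed] with s hs
        exact htop _ hs _
    _ = ⊤ := by
        rw [lintegral_const, Measure.restrict_apply_univ, Real.volume_Ioo,
          ENNReal.top_mul (by simpa using hl)]

end Curves

/-- Prepending a segment to a curve costs at most a multiple of the length of the segment. -/
theorem finslerDist_le_segment_add {Ω : Set (Sp n)} {K : Sp n → Set (Sp n)} {M : ℝ} (hM0 : 0 ≤ M)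
    (hM : ∀ z ∈ Ω, ∀ p ∈ K z, ‖p‖ ≤ M) {x : Sp n} {r : ℝ} (hB : Metric.ball x r ⊆ Ω)
    {γ : ℝ → Sp n} {t : ℝ} (ht : 0 ≤ t) {C : NNReal} (hγ : LipschitzOnWith C γ (Icc 0 t))
    (hmaps : MapsTo γ (Icc 0 t) Ω)
    (h1 : ∀ᵐ s ∂volume.restrict (Ioo 0 t), ‖deriv γ s‖ = 1) (h0 : γ 0 ∈ Metric.ball x r) :
    finslerDist Ω K x (γ t) ≤ ENNReal.ofReal (M * ‖γ 0 - x‖) +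
      ∫⁻ s in Ioo 0 t, supportFn K (γ s) (deriv γ s) := by
  set h := ‖γ 0 - x‖ with hh
  have hh0 : 0 ≤ h := norm_nonneg _
  set e : Sp n := h⁻¹ • (γ 0 - x) with he
  have hhe : h • e = γ 0 - x := by
    rcases eq_or_ne h 0 with h0 | h0
    · rw [h0, zero_smul, eq_comm, ← norm_eq_zero, ← hh, h0]
    · rw [he, smul_inv_smul₀ h0]
  have he1 : 0 < h → ‖e‖ = 1 := fun hpos => by
    rw [he, norm_smul, norm_inv, Real.norm_of_nonneg hh0, ← hh, inv_mul_cancel₀ hpos.ne']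
  -- truncating the two times makes the concatenation a sum of Lipschitz functions
  set σ : ℝ → Sp n := fun s => x + min s h • e + (γ (max (s - h) 0) - γ 0) with hσ
  have hσ1 : ∀ s ≤ h, σ s = x + s • e := fun s hs => by
    simp [hσ, min_eq_left hs, max_eq_right (sub_nonpos.2 hs)]
  have hσ2 : ∀ s, h ≤ s → σ s = γ (s - h) := fun s hs => by
    simp [hσ, min_eq_right hs, max_eq_left (sub_nonneg.2 hs), hhe]
  have hd1 : ∀ s ∈ Ioo 0 h, deriv σ s = e := by
    intro s hs
    have : σ =ᶠ[𝓝 s] fun s => x + s • e := by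
      filter_upwards [Iio_mem_nhds hs.2] with s' hs'
      exact hσ1 s' (le_of_lt hs')
    rw [this.deriv_eq]
    have h3 : HasDerivAt (fun s : ℝ => x + s • e) e s := by
      simpa using ((hasDerivAt_id s).smul_const e).const_add x
    exact h3.deriv
  have hd2 : ∀ s ∈ Ioo h (h + t), deriv σ s = deriv γ (s - h) := by
    intro s hs
    have : σ =ᶠ[𝓝 s] fun s => γ (s - h) := by
      filter_upwards [Ioi_mem_nhds hs.1] with s' hs'
      exact hσ2 s' (le_of_lt hs')
    rw [this.deriv_eq, deriv_comp_sub_const]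
  have hne : ∀ᵐ s : ℝ ∂volume, s ≠ h := by
    simp [ae_iff]
  have hpath : IsPath Ω x (γ t) (h + t) σ := by
    refine ⟨add_nonneg hh0 ht, ?_, ?_, ?_, ?_, ?_⟩
    · have l1 : LipschitzOnWith 1 (fun s : ℝ => min s h) (Icc 0 (h + t)) :=
        (LipschitzWith.id.min_const h).lipschitzOnWith
      have l2 : LipschitzOnWith 1 (fun s : ℝ => max (s - h) 0) (Icc 0 (h + t)) := by
        have : LipschitzWith 1 fun s : ℝ => s - h := LipschitzWith.of_dist_le_mul fun a b => by
          simp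
        exact (this.max_const 0).lipschitzOnWith
      have l3 : LipschitzWith ‖e‖₊ (fun s : ℝ => s • e) := LipschitzWith.of_dist_le_mul fun a b => by
        rw [dist_eq_norm, dist_eq_norm, ← sub_smul, norm_smul, mul_comm, coe_nnnorm]
      have l4 := (LipschitzWith.const x).lipschitzOnWith (s := Icc 0 (h + t)) |>.add
        (l3.comp_lipschitzOnWith l1)
      have l5 := hγ.comp l2 fun s hs => by
        refine ⟨le_max_right _ _, max_le ?_ ht⟩
        linarith [hs.2]
      exact ⟨_, l4.add (l5.sub ((LipschitzWith.const (γ 0)).lipschitzOnWith))⟩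
    · intro s hs
      rcases le_total s h with hsh | hsh
      · rw [hσ1 s hsh]
        apply hB
        rcases hh0.eq_or_lt with h' | h'
        · have : s = 0 := le_antisymm (hsh.trans h'.symm.le) hs.1
          rw [this, zero_smul, add_zero]
          exact Metric.mem_ball_self (dist_nonneg.trans_lt h0)
        · rw [Metric.mem_ball, dist_eq_norm, add_sub_cancel_left, norm_smul, he1 h', mul_one,
            Real.norm_of_nonneg hs.1]
          rw [Metric.mem_ball, dist_eq_norm] at h0
          exact hsh.trans_lt h0
      · rw [hσ2 s hsh]
        exact hmaps ⟨sub_nonneg.2 hsh, by linarith [hs.2]⟩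
    · rw [hσ1 0 hh0, zero_smul, add_zero]
    · rw [hσ2 _ (le_add_of_nonneg_right ht), add_sub_cancel_left]
    · rw [ae_restrict_iff' measurableSet_Ioo] at h1 ⊢
      have h1' := (measurePreserving_sub_right volume h).quasiMeasurePreserving.ae h1
      filter_upwards [hne, h1'] with s hs hs' hs2
      rcases lt_or_gt_of_ne hs with hlt | hgt
      · rw [hd1 s ⟨hs2.1, hlt⟩]
        exact he1 (hs2.1.trans hlt)
      · rw [hd2 s ⟨hgt, hs2.2⟩]
        exact hs' ⟨sub_pos.2 hgt, by linarith [hs2.2]⟩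
  refine (iInf_le_of_le (h + t) (iInf_le_of_le σ (iInf_le _ hpath))).trans ?_
  have hsub : Ioo 0 (h + t) ⊆ Ioc 0 h ∪ Ioo h (h + t) := fun s hs =>
    (le_or_gt s h).elim (fun h' => Or.inl ⟨hs.1, h'⟩) fun h' => Or.inr ⟨h', hs.2⟩
  refine (lintegral_mono_set hsub).trans ((lintegral_union_le _ _ _).trans ?_)
  refine add_le_add ?_ (le_of_eq ?_)
  · rw [setLIntegral_congr Ioo_ae_eq_Ioc.symm]
    calc _ ≤ ∫⁻ s in Ioo 0 h, ENNReal.ofReal M := by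
          refine setLIntegral_mono' measurableSet_Ioo fun s hs => ?_
          rw [hd1 s hs]
          have hs' := hpath.mapsTo ⟨hs.1.le, hs.2.le.trans (le_add_of_nonneg_right ht)⟩
          exact supportFn_le_of_norm_le (hM _ hs') (he1 (hs.1.trans hs.2))
      _ = _ := by
          rw [lintegral_const, Measure.restrict_apply_univ, Real.volume_Ioo, sub_zero,
            ENNReal.ofReal_mul hM0]
  · rw [← lintegral_indicator measurableSet_Ioo, ← lintegral_indicator measurableSet_Ioo,
      ← lintegral_sub_right_eq_self ((Ioo 0 t).indicator _) h]
    congr 1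
    ext s
    by_cases hs : s ∈ Ioo h (h + t)
    · have hs' : s - h ∈ Ioo 0 t := ⟨sub_pos.2 hs.1, by linarith [hs.2]⟩
      rw [indicator_of_mem hs, indicator_of_mem hs', hσ2 s hs.1.le, hd2 s hs]
    · have hs' : s - h ∉ Ioo 0 t := fun h' => hs ⟨sub_pos.1 h'.1, by linarith [h'.2]⟩
      rw [indicator_of_notMem hs, indicator_of_notMem hs']

/-! ### The extremal extensions at a point -/

section Extremal

variable {Ω : Set (Sp n)} {H : Sp n → Sp n → ℝ} {μ ν : ℝ≥0∞} {u g : Sp n → ℝ}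

/-- The bound on increments passes to the boundary by continuity of `u` on the closure. -/
theorem le_extPlus {K : Sp n → Set (Sp n)} (huc : ContinuousOn u (closure Ω))
    (hug : ∀ y ∈ frontier Ω, u y = g y)
    (hu : ∀ a ∈ Ω, ∀ b ∈ Ω, ENNReal.ofReal (u b - u a) ≤ finslerDist Ω K a b)
    {x : Sp n} (hx : x ∈ Ω) : (u x : EReal) ≤ extPlus Ω K g x := by
  refine le_iInf₂ fun y hy => ?_
  have hlim : ∀ (w : Sp n) (c : ℕ → Sp n), w ∈ closure Ω → (∀ k, c k ∈ Ω) →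
      Tendsto c atTop (𝓝 w) → Tendsto (fun k => u (c k)) atTop (𝓝 (u w)) := fun w c hw hc hcw =>
    (huc w hw).tendsto.comp (tendsto_nhdsWithin_iff.2
      ⟨hcw, Eventually.of_forall fun k => subset_closure (hc k)⟩)
  have key : ENNReal.ofReal (u x - g y) ≤ finslerDistBar Ω K y x := by
    refine le_iInf fun a => le_iInf fun b => le_iInf fun ha => le_iInf fun hb => le_iInf fun hay =>
      le_iInf fun hbx => ?_
    have h1 : Tendsto (fun k => ENNReal.ofReal (u (b k) - u (a k))) atTop
        (𝓝 (ENNReal.ofReal (u x - g y))) := by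
      rw [← hug y hy]
      exact ENNReal.tendsto_ofReal ((hlim x b (subset_closure hx) hb hbx).sub
        (hlim y a (frontier_subset_closure hy) ha hay))
    rw [← h1.liminf_eq]
    exact liminf_le_liminf (Eventually.of_forall fun k => hu _ (ha k) _ (hb k))
  induction hD : finslerDistBar Ω K y x using ENNReal.recTopCoe with
  | top => simp
  | coe D =>
    rw [hD, ENNReal.ofReal_le_iff_le_toReal ENNReal.coe_ne_top, ENNReal.coe_toReal] at key
    have : u x ≤ g y + D := by linarith
    rw [EReal.coe_nnreal_eq_coe_real]
    exact_mod_cast this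

/-- Where `u` does not exceed the lower extremal extension there are almost optimal pairs, from
near `x` to points at a fixed distance from `x`. -/
theorem exists_finslerDist_lt {K : Sp n → Set (Sp n)} (hΩ : IsOpen Ω)
    (huc : ContinuousOn u (closure Ω)) (hug : ∀ y ∈ frontier Ω, u y = g y)
    {x : Sp n} (hx : x ∈ Ω) (hS : (u x : EReal) ≤ extMinus Ω K g x) :
    ∃ ρ > 0, ∀ ε > 0, ∃ a ∈ Ω, ∃ b ∈ Ω, ‖a - x‖ < ε ∧ ρ ≤ ‖b - x‖ ∧
      finslerDist Ω K a b < ENNReal.ofReal (u b - u x + ε) := by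
  obtain ⟨R, hR, hRΩ⟩ := Metric.isOpen_iff.1 hΩ x hx
  refine ⟨R / 2, half_pos hR, fun ε hε => ?_⟩
  have h1 : ((u x - ε / 2 : ℝ) : EReal) < extMinus Ω K g x :=
    lt_of_lt_of_le (by exact_mod_cast sub_lt_self _ (half_pos hε)) hS
  obtain ⟨z, hz⟩ := lt_iSup_iff.1 h1
  obtain ⟨hzf, hz⟩ := lt_iSup_iff.1 hz
  have hD : finslerDistBar Ω K x z < ENNReal.ofReal (g z - u x + ε / 2) := by
    induction hD : finslerDistBar Ω K x z using ENNReal.recTopCoe with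
    | top => simp [hD] at hz
    | coe D =>
      rw [hD, EReal.coe_nnreal_eq_coe_real] at hz
      have hz' : u x - ε / 2 < g z - D := by exact_mod_cast hz
      rw [ENNReal.lt_ofReal_iff_toReal_lt ENNReal.coe_ne_top, ENNReal.coe_toReal]
      linarith
  simp only [finslerDistBar, iInf_lt_iff] at hD
  obtain ⟨a, b, ha, hb, hax, hbz, hlt⟩ := hD
  have hfreq := frequently_lt_of_liminf_lt (by isBoundedDefault) hlt
  have hub : Tendsto (fun k => u (b k)) atTop (𝓝 (g z)) := by
    rw [← hug z hzf]
    exact (huc z (frontier_subset_closure hzf)).tendsto.comp (tendsto_nhdsWithin_iff.2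
      ⟨hbz, Eventually.of_forall fun k => subset_closure (hb k)⟩)
  have hzR : R ≤ ‖z - x‖ := by
    by_contra! h
    have hzΩ : z ∈ Ω := hRΩ (by rwa [Metric.mem_ball, dist_eq_norm])
    rw [hΩ.frontier_eq] at hzf
    exact hzf.2 hzΩ
  have e1 : ∀ᶠ k in atTop, ‖a k - x‖ < ε := by
    filter_upwards [hax (Metric.ball_mem_nhds x hε)] with k hk
    rwa [← dist_eq_norm]
  have e2 : ∀ᶠ k in atTop, R / 2 < ‖b k - x‖ :=
    ((hbz.sub_const x).norm).eventually_const_lt (by linarith)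
  have e3 : ∀ᶠ k in atTop, g z - ε / 2 < u (b k) :=
    hub.eventually_const_lt (by linarith)
  obtain ⟨k, hk, hk1, hk2, hk3⟩ := (hfreq.and_eventually (e1.and (e2.and e3))).exists
  exact ⟨a k, ha k, b k, hb k, hk1, hk2.le, hk.trans_le (ENNReal.ofReal_le_ofReal (by linarith))⟩

/-- Where `u` equals the lower extremal extension, the increments of `u` at `x` are not bounded
by the distance of a level `ν < μ`, in any neighbourhood: along an almost optimal curve for `μ`
issuing from near `x`, the increment is nearly the `μ`-length of every initial piece, which
exceeds the `ν`-length by a fixed multiple of the Euclidean length. -/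
theorem not_forall_ofReal_sub_le_finslerDist (hΩ : IsOpen Ω) (hH : IsSupremand Ω H) (hμ : μ ≠ ⊤)
    (hu : HasGradientIn Ω (sublevel H μ) u) (huc : ContinuousOn u (closure Ω))
    (hug : ∀ y ∈ frontier Ω, u y = g y) {x : Sp n} (hx : x ∈ Ω)
    (hS : (u x : EReal) ≤ extMinus Ω (sublevel H μ) g x) (hνμ : ν < μ) {r : ℝ} (hr : 0 < r) :
    ¬ ∀ y ∈ Metric.ball x r,
      ENNReal.ofReal (u y - u x) ≤ finslerDist Ω (sublevel H ν) x y := by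
  intro hle
  obtain ⟨ρ, hρ, hopt⟩ := exists_finslerDist_lt hΩ huc hug hx hS
  obtain ⟨R, hR, hRΩ⟩ := Metric.isOpen_iff.1 hΩ x hx
  obtain ⟨M, hM0, hM⟩ := hH.exists_norm_le ((hνμ.trans_le le_top).ne)
  obtain ⟨α, hα, hgap⟩ := hH.exists_supportFn_add_le hνμ hμ
  set m := min ρ (min r R) with hm
  have hm0 : 0 < m := lt_min hρ (lt_min hr hR)
  have hmρ : m ≤ ρ := min_le_left _ _
  have hmr : m ≤ r := (min_le_right _ _).trans (min_le_left _ _)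
  have hmR : m ≤ R := (min_le_right _ _).trans (min_le_right _ _)
  -- the curve is cut at distance `m / 2` from `x`, hence at a time at least `m / 4`
  set ε := min (m / 4) (α * (m / 4) / (1 + M)) with hε
  have hε0 : 0 < ε := by positivity
  have hε1 : ε ≤ m / 4 := min_le_left _ _
  have hε2 : (1 + M) * ε ≤ α * (m / 4) := by
    have : ε ≤ α * (m / 4) / (1 + M) := min_le_right _ _
    rw [le_div_iff₀ (by linarith)] at this
    linarith
  obtain ⟨a, haΩ, b, hbΩ, hax, hbx, hab⟩ := hopt ε hε0
  simp only [finslerDist, iInf_lt_iff] at hab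
  obtain ⟨l, γ, hγ, hlen⟩ := hab
  obtain ⟨C, hC⟩ := hγ.lipschitz
  obtain ⟨t, ht, hwt⟩ : m / 2 ∈ (fun s => ‖γ s - x‖) '' Icc 0 l := by
    refine intermediate_value_Icc hγ.nonneg ((hC.continuousOn.sub continuousOn_const).norm) ⟨?_, ?_⟩
    · change ‖γ 0 - x‖ ≤ m / 2
      rw [hγ.source]; linarith
    · change m / 2 ≤ ‖γ l - x‖
      rw [hγ.target]; linarith
  have hwt : ‖γ t - x‖ = m / 2 := hwt
  have hsub1 : Icc 0 t ⊆ Icc 0 l := Icc_subset_Icc_right ht.2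
  have hsub2 : Icc t l ⊆ Icc 0 l := Icc_subset_Icc_left ht.1
  have hus1 : ∀ᵐ s ∂volume.restrict (Ioo 0 t), ‖deriv γ s‖ = 1 :=
    ae_restrict_of_ae_restrict_of_subset (Ioo_subset_Ioo_right ht.2) hγ.unit_speed
  have hus2 : ∀ᵐ s ∂volume.restrict (Ioo t l), ‖deriv γ s‖ = 1 :=
    ae_restrict_of_ae_restrict_of_subset (Ioo_subset_Ioo_left ht.1) hγ.unit_speed
  have htm : m / 4 ≤ t := by
    have h1 := norm_sub_le_of_unit_speed ht.1 (hC.mono hsub1) hus1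
    rw [hγ.source] at h1
    have h2 : ‖γ t - x‖ ≤ ‖γ t - a‖ + ‖a - x‖ := norm_sub_le_norm_sub_add_norm_sub _ _ _
    linarith
  set I₁ := ∫⁻ s in Ioo 0 t, supportFn (sublevel H μ) (γ s) (deriv γ s) with hI₁
  set I₂ := ∫⁻ s in Ioo t l, supportFn (sublevel H μ) (γ s) (deriv γ s) with hI₂
  set J := ∫⁻ s in Ioo 0 t, supportFn (sublevel H ν) (γ s) (deriv γ s) with hJ
  have hI : I₁ + I₂ < ENNReal.ofReal (u b - u x + ε) := by
    refine lt_of_le_of_lt ?_ hlen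
    rw [hI₁, hI₂, ← lintegral_union measurableSet_Ioo]
    · exact lintegral_mono_set (union_subset (Ioo_subset_Ioo_right ht.2)
        (Ioo_subset_Ioo_left ht.1))
    · exact Set.disjoint_left.2 fun s hs hs' => lt_asymm hs.2 hs'.1
  have h2 : ENNReal.ofReal (u b - u (γ t)) ≤ I₂ := by
    have := hu.ofReal_sub_le_lintegral hΩ hH hμ ht.2 (hC.mono hsub2) (hγ.mapsTo.mono_left hsub2) hus2
    rwa [hγ.target] at this
  have h1 : ENNReal.ofReal (u (γ t) - u x) ≤ ENNReal.ofReal (M * ε) + J := by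
    refine (hle (γ t) (by rw [Metric.mem_ball, dist_eq_norm]; linarith)).trans ?_
    refine (finslerDist_le_segment_add hM0 hM hRΩ ht.1 (hC.mono hsub1)
      (hγ.mapsTo.mono_left hsub1) hus1
      (by rw [hγ.source, Metric.mem_ball, dist_eq_norm]; linarith)).trans ?_
    rw [hγ.source]
    gcongr
  have h3 : J + ENNReal.ofReal (α * t) ≤ I₁ := by
    have e : ENNReal.ofReal (α * t) = ∫⁻ s in Ioo 0 t, ENNReal.ofReal α := by
      rw [lintegral_const, Measure.restrict_apply_univ, Real.volume_Ioo, sub_zero,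
        ENNReal.ofReal_mul hα.le]
    rw [e, hJ, ← lintegral_add_right _ measurable_const]
    refine lintegral_mono_ae ?_
    filter_upwards [hus1, ae_restrict_mem measurableSet_Ioo] with s hs hs'
    exact hgap _ (hγ.mapsTo (hsub1 (Ioo_subset_Icc_self hs'))) _ hs
  have hfin : I₁ + I₂ ≠ ⊤ := (hI.trans_le le_top).ne
  have hf1 : I₁ ≠ ⊤ := fun h => hfin (by rw [h, top_add])
  have hf2 : I₂ ≠ ⊤ := fun h => hfin (by rw [h, add_top])
  have hfJ : J ≠ ⊤ := ne_top_of_le_ne_top hf1 (le_self_add.trans h3)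
  have hMε : 0 ≤ M * ε := by positivity
  rw [ENNReal.lt_ofReal_iff_toReal_lt hfin, ENNReal.toReal_add hf1 hf2] at hI
  rw [ENNReal.ofReal_le_iff_le_toReal hf2] at h2
  rw [ENNReal.ofReal_le_iff_le_toReal (ENNReal.add_ne_top.2 ⟨ENNReal.ofReal_ne_top, hfJ⟩),
    ENNReal.toReal_add ENNReal.ofReal_ne_top hfJ, ENNReal.toReal_ofReal hMε] at h1
  have h3' := ENNReal.toReal_mono hf1 h3
  rw [ENNReal.toReal_add hfJ ENNReal.ofReal_ne_top,
    ENNReal.toReal_ofReal (mul_nonneg hα.le ht.1)] at h3'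
  have h4 : α * (m / 4) ≤ α * t := mul_le_mul_of_nonneg_left htm hα.le
  linarith

/-- At a point of differentiability, the increments of `u` are bounded by the distance of every
level above that of the gradient. -/
theorem exists_forall_ofReal_sub_le_finslerDist (hΩ : IsOpen Ω) (hH : IsSupremand Ω H)
    (hν : ν ≠ ⊤) {x p : Sp n} (hx : x ∈ Ω) (hp : HasGradientAt u p x) (hlt : H x p < ν.toReal) :
    ∃ r > 0, ∀ y ∈ Metric.ball x r,
      ENNReal.ofReal (u y - u x) ≤ finslerDist Ω (sublevel H ν) x y := by
  have hν0 : 0 < ν := (ENNReal.toReal_pos_iff.1 ((hH.nonneg x hx p).trans_lt hlt)).1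
  obtain ⟨β, hβ, hball⟩ := hH.exists_closedBall_subset_sublevel hν0 hν
  obtain ⟨δ, hδ, hnear⟩ := Metric.eventually_nhds_iff_ball.1
    ((hH.continuousAt hΩ hx p).eventually_lt continuousAt_const hlt)
  set η := δ / 2 with hη
  have hη0 : 0 < η := half_pos hδ
  have e1 := (hasGradientAt_iff_isLittleO.1 hp).def hη0
  have e2 : ∀ᶠ y in 𝓝 x, u y < u x + β * η :=
    hp.continuousAt.tendsto.eventually_lt_const (lt_add_of_pos_right _ (mul_pos hβ hη0))
  obtain ⟨r, hr, hall⟩ := Metric.eventually_nhds_iff_ball.1 (e1.and e2)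
  refine ⟨r, hr, fun y hy => le_iInf fun l => le_iInf fun γ => le_iInf fun hγ => ?_⟩
  obtain ⟨hy1, hy2⟩ := hall y hy
  obtain ⟨C, hC⟩ := hγ.lipschitz
  -- a curve that stays near `x` is tested against `p` tilted towards `y`; one that leaves a ball
  -- around `x` is long enough for the uniform lower bound of the support function
  by_cases hin : ∀ s ∈ Icc 0 l, ‖γ s - x‖ < δ
  · obtain ⟨e, he, he'⟩ := exists_norm_le_one_inner_eq_norm (y - x)
    have h := ofReal_inner_sub_le_lintegral hγ.nonneg hC hγ.unit_speed (p := p + η • e)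
      (φ := fun s => supportFn (sublevel H ν) (γ s) (deriv γ s)) (fun s hs _ => by
        refine ofReal_inner_le_supportFn ((mem_sublevel_iff hν).2 (le_of_lt ?_)) _
        refine hnear (γ s, p + η • e) ?_
        rw [← ball_prod_same]
        refine ⟨?_, ?_⟩
        · rw [Metric.mem_ball, dist_eq_norm]
          exact hin s (Ioo_subset_Icc_self hs)
        · rw [Metric.mem_ball, dist_eq_norm, add_sub_cancel_left, norm_smul,
            Real.norm_of_nonneg hη0.le]
          nlinarith)
    rw [hγ.source, hγ.target, inner_add_left, real_inner_smul_left, he'] at h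
    refine (ENNReal.ofReal_le_ofReal ?_).trans h
    have := (le_abs_self _).trans hy1
    linarith
  · push Not at hin
    obtain ⟨s, hs, hsδ⟩ := hin
    obtain ⟨e, he, he'⟩ := exists_norm_le_one_inner_eq_norm (γ s - x)
    have hsub : Icc 0 s ⊆ Icc 0 l := Icc_subset_Icc_right hs.2
    have h := ofReal_inner_sub_le_lintegral hs.1 (hC.mono hsub)
      (ae_restrict_of_ae_restrict_of_subset (Ioo_subset_Ioo_right hs.2) hγ.unit_speed)
      (p := β • e) (φ := fun s => supportFn (sublevel H ν) (γ s) (deriv γ s)) (fun s' hs' _ => by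
        refine ofReal_inner_le_supportFn
          (hball _ (hγ.mapsTo (hsub (Ioo_subset_Icc_self hs'))) _ ?_) _
        rw [norm_smul, Real.norm_of_nonneg hβ.le]
        nlinarith)
    rw [hγ.source, real_inner_smul_left, he'] at h
    refine (ENNReal.ofReal_le_ofReal ?_).trans (h.trans
      (lintegral_mono_set (Ioo_subset_Ioo_right hs.2)))
    have : β * η ≤ β * ‖γ s - x‖ := mul_le_mul_of_nonneg_left (by linarith) hβ.le
    linarith

/-- The almost everywhere constraint on the weak gradient holds at every point of
differentiability, by joint upper semicontinuity of the support function. -/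
theorem HasGradientIn.gradient_mem (hΩ : IsOpen Ω) (hH : IsSupremand Ω H) (hν : ν ≠ ⊤)
    (hu : HasGradientIn Ω (sublevel H ν) u) {x p : Sp n} (hx : x ∈ Ω) (hp : HasGradientAt u p x) :
    p ∈ sublevel H ν x := by
  refine hH.mem_sublevel_of_inner_le hν hx fun q => ?_
  by_contra! hlt
  obtain ⟨c, -, hc1, hc2⟩ := ENNReal.lt_iff_exists_real_btwn.1 hlt
  obtain ⟨δ, hδ, hsub⟩ := hu.exists_sub_le hΩ hH hν hx hc1
  have hline : HasDerivAt (fun t : ℝ => u (x + t • q)) ⟪p, q⟫_ℝ 0 := by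
    have h3 : HasDerivAt (fun t : ℝ => x + t • q) q 0 := by
      simpa using ((hasDerivAt_id (0 : ℝ)).smul_const q).const_add x
    have h4 : HasFDerivAt u (InnerProductSpace.toDual ℝ (Sp n) p) (x + (0 : ℝ) • q) := by
      rw [zero_smul, add_zero]
      exact hp.hasFDerivAt
    have h5 := h4.comp_hasDerivAt (0 : ℝ) h3
    rwa [InnerProductSpace.toDual_apply_apply] at h5
  have hcont : Tendsto (fun t : ℝ => x + t • q) (𝓝[>] 0) (𝓝 x) := by
    have : Continuous fun t : ℝ => x + t • q := by fun_prop
    have h := this.tendsto 0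
    rw [zero_smul, add_zero] at h
    exact h.mono_left nhdsWithin_le_nhds
  have hle : ⟪p, q⟫_ℝ ≤ c := by
    refine le_of_tendsto hline.tendsto_slope_zero_right ?_
    filter_upwards [hcont (Metric.ball_mem_nhds _ hδ), self_mem_nhdsWithin] with t ht1 ht2
    have ht2 : 0 < t := ht2
    have := hsub x (Metric.mem_ball_self hδ) q (Metric.mem_ball_self hδ) t ht2.le ht1
    rw [smul_eq_mul, inv_mul_le_iff₀ ht2, mul_comm t c, zero_add, zero_smul, add_zero]
    exact this
  exact absurd (ENNReal.ofReal_le_ofReal hle) (not_le.2 hc2)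

end Extremal

/-! ### Minimizers -/

/-- Integrability of both functions is needed, since the sum of two divergent Bochner integrals
need not be the integral of the sum. -/
theorem IsWeakGradient.add {Ω : Set (Sp n)} {u v : Sp n → ℝ} {G F : Sp n → Sp n}
    (hG : IsWeakGradient Ω u G) (hF : IsWeakGradient Ω v F) (hu : IntegrableOn u Ω)
    (hv : IntegrableOn v Ω) : IsWeakGradient Ω (u + v) (G + F) := by
  refine ⟨hG.locallyIntegrable.add hF.locallyIntegrable, fun φ hφ hc hs w => ?_⟩
  have hint : ∀ f : Sp n → ℝ, IntegrableOn f Ω →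
      Integrable (fun x => f x * fderiv ℝ φ x w) (volume.restrict Ω) := by
    intro f hf
    have hcont : Continuous fun x => fderiv ℝ φ x w :=
      (hφ.continuous_fderiv (by simp)).clm_apply continuous_const
    obtain ⟨B, hB⟩ := hcont.bounded_above_of_compact_support (hc.fderiv_apply ℝ w)
    exact hf.mul_bdd hcont.aestronglyMeasurable (Eventually.of_forall hB)
  have hint' : ∀ F : Sp n → Sp n, LocallyIntegrableOn F Ω →
      Integrable (fun x => φ x * ⟪F x, w⟫_ℝ) (volume.restrict Ω) := fun F hF =>
    (integrable_mul_inner_of_tsupport_subset hF hφ.continuous hc hs w).restrict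
  simp only [Pi.add_apply, add_mul, inner_add_left, mul_add]
  rw [integral_add (hint u hu) (hint v hv),
    integral_add (hint' G hG.locallyIntegrable) (hint' F hF.locallyIntegrable),
    hG.integral_eq φ hφ hc hs w, hF.integral_eq φ hφ hc hs w, neg_add]

theorem MemW1Inf.add {Ω : Set (Sp n)} (hΩ : Bornology.IsBounded Ω) {u v : Sp n → ℝ}
    (hu : MemW1Inf Ω u) (hv : MemW1Inf Ω v) : MemW1Inf Ω (u + v) := by
  have : IsFiniteMeasure (volume.restrict Ω) := ⟨by
    rw [Measure.restrict_apply_univ]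
    exact hΩ.measure_lt_top⟩
  obtain ⟨hu1, G, hG, hG'⟩ := hu
  obtain ⟨hv1, F, hF, hF'⟩ := hv
  exact ⟨hu1.add hv1, G + F, hG.add hF (hu1.integrable le_top) (hv1.integrable le_top),
    hG'.add hF'⟩

theorem IsMinimizer.supremal_eq {Ω : Set (Sp n)} {H : Sp n → Sp n → ℝ} {g u : Sp n → ℝ}
    (hu : IsMinimizer Ω H g u) : supremal Ω H u = minValue Ω H g :=
  le_antisymm (le_iInf₂ hu.le) (iInf₂_le u hu.admissible)

theorem IsAdmissible.hasGradientIn {Ω : Set (Sp n)} (hΩ : Bornology.IsBounded Ω)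
    {H : Sp n → Sp n → ℝ} {g u : Sp n → ℝ} (hg : MemW1Inf Ω g)
    (hg_cont : ContinuousOn g (closure Ω)) (hu : IsAdmissible Ω g u) :
    HasGradientIn Ω (sublevel H (supremal Ω H u)) u := by
  have : IsFiniteMeasure (volume.restrict Ω) := ⟨by
    rw [Measure.restrict_apply_univ]
    exact hΩ.measure_lt_top⟩
  have hW : MemW1Inf Ω u := by simpa using hu.sobolev.add hΩ hg
  have hc : ContinuousOn u (closure Ω) := by simpa using hu.continuousOn.add hg_cont
  exact ⟨hc.mono subset_closure, hW.1.integrable le_top, weakGrad Ω u, hW.isWeakGradient,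
    ENNReal.ae_le_essSup fun x => ENNReal.ofReal (H x (weakGrad Ω u x))⟩

end Supremal
end

theorem mainTheorem10 {n : ℕ} (Ω : Set (Supremal.Sp n)) (hΩ_open : IsOpen Ω)
    (hΩ_conn : IsConnected Ω) (hΩ_bdd : Bornology.IsBounded Ω)
    (H : Supremal.Sp n → Supremal.Sp n → ℝ) (hH : Supremal.IsSupremand Ω H)
    (g : Supremal.Sp n → ℝ) (hg : Supremal.MemW1Inf Ω g) (hg_cont : ContinuousOn g (closure Ω))
    (u : Supremal.Sp n → ℝ) (hu : Supremal.IsMinimizer Ω H g u) (x : Supremal.Sp n)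
    (hx : x ∈ Supremal.uniquenessSet Ω
      (Supremal.sublevel H (Supremal.minValue Ω H g)) g) :
    Supremal.supremal Ω H u = Supremal.minValue Ω H g ∧
    (DifferentiableAt ℝ u x →
      ENNReal.ofReal (H x (gradient u x)) = Supremal.supremal Ω H u) ∧
    Supremal.pointwiseExt Ω H u x = Supremal.supremal Ω H u := by
  have hF := hu.supremal_eq
  rw [hF]
  set μ := Supremal.minValue Ω H g with hμdef
  obtain ⟨hxΩ, hS⟩ := hx
  have huK : Supremal.HasGradientIn Ω (Supremal.sublevel H μ) u :=
    hF ▸ hu.admissible.hasGradientIn hΩ_bdd hg hg_cont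
  have huc : ContinuousOn u (closure Ω) := by simpa using hu.admissible.continuousOn.add hg_cont
  have hug : ∀ y ∈ frontier Ω, u y = g y := fun y hy =>
    sub_eq_zero.1 (hu.admissible.boundary y hy)
  have hdist : ∀ a b, ENNReal.ofReal (u b - u a) ≤
      Supremal.finslerDist Ω (Supremal.sublevel H μ) a b := by
    intro a b
    rcases eq_or_ne μ ⊤ with hμ | hμ
    · rcases eq_or_ne a b with rfl | hab
      · simp
      · rw [hμ, Supremal.finslerDist_sublevel_top hab]
        exact le_top
    · exact Supremal.ofReal_sub_le_finslerDist hΩ_open hH hμ huK a b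
  have hSm : (u x : EReal) ≤ Supremal.extMinus Ω (Supremal.sublevel H μ) g x :=
    (Supremal.le_extPlus huc hug (fun a _ b _ => hdist a b) hxΩ).trans_eq hS
  obtain ⟨ρ, hρ, hopt⟩ := Supremal.exists_finslerDist_lt hΩ_open huc hug hxΩ hSm
  -- at infinite level no distance between distinct points is finite
  have hμ : μ ≠ ⊤ := by
    intro hμ
    obtain ⟨a, -, b, -, ha, hb, hlt⟩ := hopt ρ hρ
    rw [hμ, Supremal.finslerDist_sublevel_top (by rintro rfl; exact absurd hb (not_le.2 ha))] at hlt
    exact not_top_lt hlt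
  refine ⟨rfl, fun hd => ?_, ?_⟩
  · have hp := hd.hasGradientAt
    refine le_antisymm (huK.gradient_mem hΩ_open hH hμ hxΩ hp) ?_
    by_contra! hlt
    obtain ⟨ν, hν1, hν2⟩ := exists_between hlt
    have hν : ν ≠ ⊤ := (hν2.trans_le le_top).ne
    obtain ⟨r, hr, hle⟩ := Supremal.exists_forall_ofReal_sub_le_finslerDist hΩ_open hH hν hxΩ hp
      ((ENNReal.ofReal_lt_iff_lt_toReal (hH.nonneg x hxΩ _) hν).1 hν1)
    exact Supremal.not_forall_ofReal_sub_le_finslerDist hΩ_open hH hμ huK huc hug hxΩ hSm hν2 hr hle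
  · refine le_antisymm ?_ ?_
    · have hne : (frontier Ω).Nonempty := by
        rw [Set.nonempty_iff_ne_empty]
        intro h
        simp [Supremal.extMinus, h] at hSm
      have hxf : x ∉ frontier Ω := fun h => by
        rw [hΩ_open.frontier_eq] at h
        exact h.2 hxΩ
      have hpos : 0 < Metric.infDist x (frontier Ω) :=
        (isClosed_frontier.notMem_iff_infDist_pos hne).1 hxf
      exact iInf_le_of_le (Metric.infDist x (frontier Ω) / 2) (iInf_le_of_le (half_pos hpos)
        (iInf_le_of_le (half_lt_self hpos) (sInf_le fun y _ => hdist x y)))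
    · refine le_iInf fun r => le_iInf fun hr => le_iInf fun _ => le_sInf fun ν hν => ?_
      by_contra! hlt
      exact Supremal.not_forall_ofReal_sub_le_finslerDist hΩ_open hH hμ huK huc hug hxΩ hSm hlt hr hν
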